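/- Let $n,m,k$ be nonnegative integers, let $g:\mathbb R^n\to\mathbb R$ be differentiable, $\tilde x\in\mathbb R^n$, $0<\epsilon<1$, $\tilde\mu\in\mathbb R^n$, let $\tilde\Sigma\in\mathbb R^{n\times n}$ be symmetric positive definite, $A\in\mathbb R^{n\times m}$, $B\in\mathbb R^{n\times k}$, and $\alpha,\beta\ge 0$. Write $X\bullet Y=\operatorname{tr}(X^\top Y)$, $\|X\|_{1,1}=\sum_{i,j}|X_{ij}|$, $\|X\|_{\infty,\infty}=\max_{i,j}|X_{ij}|$, $\|X\|_F=\sqrt{X\bullet X}$, let $\mathcal S^n$ be the set of real symmetric $n\times n$ matrices and $\mathcal S^n_+$ the set of positive semidefinite ones, and put $$\kappa=\sqrt{\frac{1-\epsilon}{\epsilon}} .$$ For $U_\mu\subset\mathbb R^n$ and $U_\Sigma\subset\mathcal S^n_+$ let $\mathcal P(U_\mu,U_\Sigma)$ be the set of all probability distributions on $\mathbb R^n$ (of any type) with finite second moments whose expected value vector belongs to $U_\mu$ and whose variance-covariance matrix belongs to $U_\Sigma$, and consider the distributionally robust linearized reliability constraint $$\mathrm P_p\{\,g(\tilde x)+\nabla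 g(\tilde x)^\top\zeta\le 0\,\}\ \ge\ 1-\epsilon\qquad\text{for every }p\in\mathcal P(U_\mu,U_\Sigma),\tag{R}$$ where $\zeta$ denotes a random vector with distribution $p$. (i) ($\ell_\infty$-model.) Let $U_\mu=\{\tilde\mu+Az_1\mid z_1\in\mathbb R^m,\ \|z_1\|_\infty\le\alpha\}$ and $U_\Sigma=\{\tilde\Sigma+BZ_2B^\top\mid Z_2\in\mathcal S^k,\ \|Z_2\|_{\infty,\infty}\le\beta\}\cap\mathcal S^n_+$. Then (R) holds if and only if there exist $z\in\mathbb R$ and $W\in\mathcal S^n$ such that $$g(\tilde x)+\nabla g(\tilde x)^\top\tilde\mu+\alpha\|A^\top\nabla g(\tilde x)\|_1+\tilde\Sigma\bullet W+\beta\|B^\top WB\|_{1,1}+\kappa^2z\le 0,\qquad \begin{bmatrix}W&\nabla g(\tilde x)/2\\ \nabla g(\tilde x)^\top/2&z\end{bmatrix}\succeq 0 .$$ (ii) ($\ell_2$-model.) Let $U_\mu=\{\tilde\mu+Az_1\mid z_1\in\mathbb R^m,\ \|z_1\|_2\le\alpha\}$ and $U_\Sigma=\{\tilde\Sigma+BZ_2B^\top\mid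 Z_2\in\mathcal S^k,\ \|Z_2\|_F\le\beta\}\cap\mathcal S^n_+$. Then (R) holds if and only if there exist $z\in\mathbb R$ and $W\in\mathcal S^n$ such that $$g(\tilde x)+\nabla g(\tilde x)^\top\tilde\mu+\alpha\|A^\top\nabla g(\tilde x)\|_2+\tilde\Sigma\bullet W+\beta\|B^\top WB\|_F+\kappa^2z\le 0,\qquad \begin{bmatrix}W&\nabla g(\tilde x)/2\\ \nabla g(\tilde x)^\top/2&z\end{bmatrix}\succeq 0 .$$ -/

import Mathlib

open MeasureTheory ProbabilityTheory
open scoped Matrix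

namespace RobustReliability

noncomputable section

/-- The `ℓ₁`-norm of a real vector. -/
def normOne {m : ℕ} (v : Fin m → ℝ) : ℝ := ∑ i, |v i|

/-- The `ℓ₂`-norm of a real vector. -/
def normTwo {m : ℕ} (v : Fin m → ℝ) : ℝ := √(v ⬝ᵥ v)

/-- The `ℓ_∞`-norm of a real vector (the norm of the product space `Fin m → ℝ`). -/
def normInf {m : ℕ} (v : Fin m → ℝ) : ℝ := ‖v‖

/-- The inner product `X • Y = tr (Xᵀ Y)` of real matrices. -/
def matInner {m n : ℕ} (X Y : Matrix (Fin m) (Fin n) ℝ) : ℝ := (Xᵀ * Y).trace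

/-- The entrywise norm `‖X‖_{1,1}`, the sum of the absolute values of the entries. -/
def matNormOne {m n : ℕ} (X : Matrix (Fin m) (Fin n) ℝ) : ℝ := ∑ i, ∑ j, |X i j|

/-- The Frobenius norm `‖X‖_F`. -/
def matNormFrob {m n : ℕ} (X : Matrix (Fin m) (Fin n) ℝ) : ℝ := √(matInner X X)

/-- The entrywise norm `‖X‖_{∞,∞}`, the largest absolute value of an entry
(the norm of the product space `Fin m → Fin n → ℝ`). -/
def matNormInf {m n : ℕ} (X : Matrix (Fin m) (Fin n) ℝ) : ℝ := ‖fun i j => X i j‖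

/-- The uncertainty set of mean vectors `{μ₀ + A z | N z ≤ α}` for a vector norm `N`. -/
def meanSet {n m : ℕ} (N : (Fin m → ℝ) → ℝ) (μ₀ : EuclideanSpace ℝ (Fin n))
    (A : Matrix (Fin n) (Fin m) ℝ) (α : ℝ) : Set (EuclideanSpace ℝ (Fin n)) :=
  {μ | ∃ z : Fin m → ℝ, N z ≤ α ∧ μ = μ₀ + WithLp.toLp 2 (A *ᵥ z)}

/-- The uncertainty set of covariance matrices
`{S₀ + B Z Bᵀ | N Z ≤ β, Z symmetric}`, intersected with the positive semidefinite cone,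
for a matrix norm `N`. -/
def covSet {n k : ℕ} (N : Matrix (Fin k) (Fin k) ℝ → ℝ) (S₀ : Matrix (Fin n) (Fin n) ℝ)
    (B : Matrix (Fin n) (Fin k) ℝ) (β : ℝ) : Set (Matrix (Fin n) (Fin n) ℝ) :=
  {S | ∃ Z : Matrix (Fin k) (Fin k) ℝ, Z.IsSymm ∧ N Z ≤ β ∧ S = S₀ + B * Z * Bᵀ} ∩
    {S | S.PosSemidef}

/-- The variance-covariance matrix of a distribution on `ℝⁿ`. -/
def covMatrix {n : ℕ} (p : Measure (EuclideanSpace ℝ (Fin n))) : Matrix (Fin n) (Fin n) ℝ :=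
  Matrix.of fun i j => cov[fun ζ => ζ i, fun ζ => ζ j; p]

/-- All probability distributions on `ℝⁿ` with finite second moments, of any type, whose
expected value vector lies in `Umean` and whose variance-covariance matrix lies in `Ucov`. -/
def momentClass {n : ℕ} (Umean : Set (EuclideanSpace ℝ (Fin n)))
    (Ucov : Set (Matrix (Fin n) (Fin n) ℝ)) : Set (Measure (EuclideanSpace ℝ (Fin n))) :=
  {p | IsProbabilityMeasure p ∧ MemLp (fun ζ => ζ) 2 p ∧
    ∫ ζ, ζ ∂p ∈ Umean ∧ covMatrix p ∈ Ucov}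

/-- The linearized reliability constraint holds for every distribution in `P`:
the first-order approximation at `x` of `g (x + ζ)` is nonpositive with probability at least
`1 - ε`. -/
def RobustlyReliable {n : ℕ} (g : EuclideanSpace ℝ (Fin n) → ℝ) (x : EuclideanSpace ℝ (Fin n))
    (ε : ℝ) (P : Set (Measure (EuclideanSpace ℝ (Fin n)))) : Prop :=
  ∀ p ∈ P, 1 - ε ≤ p.real {ζ | g x + inner ℝ (gradient g x) ζ ≤ 0}

/-- The symmetric block matrix `[W, a/2; aᵀ/2, z]`. -/
def blockMatrix {n : ℕ} (W : Matrix (Fin n) (Fin n) ℝ) (a : EuclideanSpace ℝ (Fin n)) (z : ℝ) :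
    Matrix (Fin n ⊕ Unit) (Fin n ⊕ Unit) ℝ :=
  Matrix.fromBlocks W (Matrix.of fun i _ => a i / 2) (Matrix.of fun _ j => a j / 2)
    (Matrix.of fun _ _ => z)

/-- The distribution-free constant `κ = √((1 - ε) / ε)`. -/
def kappa (ε : ℝ) : ℝ := √((1 - ε) / ε)

end

end RobustReliability

/-! Write a for the gradient. By Cantelli's inequality and its sharpness over all distributions with
mean μ and covariance S, the chance constraint amounts to g(x) + aᵀμ + κ√(aᵀSa) ≤ 0 for all
admissible μ and S (`robustlyReliable_momentClass_iff`). The mean separates and contributes a dual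
norm.

For S ⪰ 0, κ√(aᵀSa) is the infimum of S • W + κ²z over pairs (W, z) with semidefinite block matrix;
for symmetric S that is not semidefinite the infimum is −∞. The worst case is thus a max-min of a
function affine in each variable, and Sion's theorem exchanges the order
(`exists_isSaddlePointOn_lagrangian`). The cone of pairs is not compact, but S₀ ≻ 0 makes the
sublevel sets of S₀ • W + κ²z on it compact. Maximizing over Z for fixed W then produces the dual
norm of BᵀWB. -/

namespace RobustReliability

/-! ### Cantelli's inequality and the covariance direction -/

section

/-- Cantelli's one-sided Chebyshev inequality, at the level where it gives probability `ε`. -/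
theorem one_sub_le_measureReal_nonpos {Ω : Type*} [MeasurableSpace Ω] {p : Measure Ω}
    [IsProbabilityMeasure p] {X : Ω → ℝ} (hX : MemLp X 2 p) (hXm : Measurable X)
    {ε : ℝ} (hε0 : 0 < ε) (hε1 : ε < 1)
    (h : ∫ ω, X ω ∂p + kappa ε * √(Var[X; p]) ≤ 0) :
    1 - ε ≤ p.real {ω | X ω ≤ 0} := by
  have hms : MeasurableSet {ω | X ω ≤ 0} := measurableSet_le hXm measurable_const
  set t := -∫ ω, X ω ∂p with ht
  set v := Var[X; p] with hv
  have hv0 : 0 ≤ v := variance_nonneg X p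
  have hκ : 0 < (1 - ε) / ε := div_pos (by linarith) hε0
  have hκ' : 0 < kappa ε := Real.sqrt_pos.2 hκ
  have hκv : 0 ≤ kappa ε * √v := by positivity
  have hle : kappa ε * √v ≤ t := by linarith
  have ht0 : 0 ≤ t := hκv.trans hle
  have hsq : (1 - ε) * v ≤ ε * t ^ 2 := by
    have h1 := pow_le_pow_left₀ hκv hle 2
    rw [mul_pow, Real.sq_sqrt hv0, kappa, Real.sq_sqrt hκ.le, div_mul_eq_mul_div,
      div_le_iff₀ hε0] at h1
    linarith
  rcases ht0.eq_or_lt with h0 | htpos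
  · have hv00 : v = 0 := by
      rw [← h0] at hsq
      nlinarith
    have hae := ae_eq_integral_of_variance_eq_zero hX hv00
    have : p {ω | X ω ≤ 0} = 1 := by
      rw [prob_compl_eq_zero_iff hms |>.symm]
      filter_upwards [hae] with ω hω
      show X ω ≤ 0
      linarith
    rw [Measure.real, this]
    simp [hε0.le]
  -- Markov's inequality for (X + t + u)² bounds P(X > 0) by (v + u²)/(t + u)². The choice u = v/t
  -- minimizes this, with value u/(t + u) ≤ ε.
  · set u := v / t with hu
    have hvu : v = u * t := by rw [hu]; field_simp
    have hu0 : 0 ≤ u := div_nonneg hv0 ht0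
    have hut : 0 < t + u := by linarith
    have hY : MemLp (fun ω => X ω + (t + u)) 2 p := hX.add (memLp_const _)
    have hVar := variance_eq_sub hY
    rw [variance_add_const hX.1] at hVar
    have hint : ∫ ω, (X ω + (t + u)) ∂p = u := by
      rw [integral_add (hX.integrable one_le_two) (integrable_const _)]
      simp only [integral_const, probReal_univ, smul_eq_mul]
      linarith
    rw [hint] at hVar
    have hmk := mul_meas_ge_le_integral_of_nonneg (μ := p)
      (f := (fun ω => X ω + (t + u)) ^ 2) (Filter.Eventually.of_forall fun ω => sq_nonneg _)
      hY.integrable_sq ((t + u) ^ 2)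
    have hsub : p.real {ω | X ω ≤ 0}ᶜ ≤
        p.real {ω | (t + u) ^ 2 ≤ ((fun ω => X ω + (t + u)) ^ 2) ω} := by
      refine measureReal_mono fun ω hω => ?_
      have : 0 < X ω := not_le.1 hω
      show (t + u) ^ 2 ≤ (X ω + (t + u)) ^ 2
      exact pow_le_pow_left₀ hut.le (by linarith) 2
    rw [probReal_compl_eq_one_sub hms] at hsub
    have h2 : (t + u) ^ 2 * (1 - p.real {ω | X ω ≤ 0}) ≤ u * (t + u) := by
      refine (mul_le_mul_of_nonneg_left hsub (sq_nonneg _)).trans (hmk.trans ?_)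
      have : ∫ ω, ((fun ω => X ω + (t + u)) ^ 2) ω ∂p = v + u ^ 2 := by linarith
      rw [this, hvu]
      linarith
    have h3 : (1 - ε) * u ≤ ε * t := by
      rw [hvu] at hsq
      have : t * ((1 - ε) * u) ≤ t * (ε * t) := by linarith
      exact le_of_mul_le_mul_left this htpos
    have h4 : (t + u) ^ 2 * (1 - p.real {ω | X ω ≤ 0}) ≤ (t + u) ^ 2 * ε := by
      refine h2.trans ?_
      have : (t + u) * u ≤ (t + u) * (ε * (t + u)) :=
        mul_le_mul_of_nonneg_left (by linarith) hut.le
      linarith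
    linarith [le_of_mul_le_mul_left h4 (pow_pos hut 2)]

variable {n : ℕ}

theorem memLp_eval {p : Measure (EuclideanSpace ℝ (Fin n))} (hp : MemLp (fun ζ => ζ) 2 p)
    (i : Fin n) : MemLp (fun ζ : EuclideanSpace ℝ (Fin n) => ζ i) 2 p :=
  (EuclideanSpace.proj (𝕜 := ℝ) i).comp_memLp' hp

theorem inner_eq_sum_mul (a ζ : EuclideanSpace ℝ (Fin n)) : inner ℝ a ζ = ∑ i, a i * ζ i := by
  simp [PiLp.inner_apply, mul_comm]

theorem inner_eq_dotProduct (a ζ : EuclideanSpace ℝ (Fin n)) :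
    inner ℝ a ζ = a.ofLp ⬝ᵥ ζ.ofLp := by
  rw [inner_eq_sum_mul]; rfl

theorem variance_inner {p : Measure (EuclideanSpace ℝ (Fin n))} [IsProbabilityMeasure p]
    (hp : MemLp (fun ζ => ζ) 2 p) (a : EuclideanSpace ℝ (Fin n)) :
    Var[fun ζ => inner ℝ a ζ; p] = a.ofLp ⬝ᵥ (covMatrix p *ᵥ a.ofLp) := by
  have hi (i : Fin n) : MemLp (fun ζ : EuclideanSpace ℝ (Fin n) => a i * ζ i) 2 p :=
    (memLp_eval hp i).const_mul _
  simp_rw [inner_eq_sum_mul]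
  rw [← covariance_self (by fun_prop), covariance_fun_sum_fun_sum hi hi]
  simp_rw [covariance_const_mul_left, covariance_const_mul_right, dotProduct, Matrix.mulVec,
    dotProduct, Finset.mul_sum, covMatrix, Matrix.of_apply]
  refine Finset.sum_congr rfl fun i _ => Finset.sum_congr rfl fun j _ => by ring

theorem integral_inner_id {p : Measure (EuclideanSpace ℝ (Fin n))} [IsProbabilityMeasure p]
    (hp : MemLp (fun ζ => ζ) 2 p) (a : EuclideanSpace ℝ (Fin n)) :
    ∫ ζ, inner ℝ a ζ ∂p = inner ℝ a (∫ ζ, ζ ∂p) :=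
  integral_inner (hp.integrable one_le_two) a

theorem integral_apply {p : Measure (EuclideanSpace ℝ (Fin n))} [IsProbabilityMeasure p]
    (hp : MemLp (fun ζ => ζ) 2 p) (i : Fin n) :
    ∫ ζ : EuclideanSpace ℝ (Fin n), ζ i ∂p = (∫ ζ, ζ ∂p) i :=
  (EuclideanSpace.proj (𝕜 := ℝ) i).integral_comp_comm (hp.integrable one_le_two)

/-- Cauchy–Schwarz for a semidefinite form: the quadratic in t given by the form at x + t a has
nonpositive discriminant. -/
theorem dotProduct_mulVec_sq_le {S : Matrix (Fin n) (Fin n) ℝ} (hS : S.PosSemidef)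
    (x a : Fin n → ℝ) : (x ⬝ᵥ (S *ᵥ a)) ^ 2 ≤ (x ⬝ᵥ (S *ᵥ x)) * (a ⬝ᵥ (S *ᵥ a)) := by
  have hT : S.IsSymm := by simpa using hS.isHermitian
  have hsymm : a ⬝ᵥ (S *ᵥ x) = x ⬝ᵥ (S *ᵥ a) := by
    rw [Matrix.dotProduct_mulVec, ← Matrix.mulVec_transpose, hT.eq, dotProduct_comm]
  have h := discrim_le_zero (a := a ⬝ᵥ (S *ᵥ a)) (b := 2 * (x ⬝ᵥ (S *ᵥ a)))
    (c := x ⬝ᵥ (S *ᵥ x)) fun t => by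
      have := hS.dotProduct_mulVec_nonneg (x + t • a)
      simp only [star_trivial, Matrix.mulVec_add, Matrix.mulVec_smul, add_dotProduct,
        dotProduct_add, smul_dotProduct, dotProduct_smul, smul_eq_mul, hsymm] at this
      linarith
  rw [discrim] at h
  linarith

/-- The standardized direction `S a / √(aᵀ S a)`. -/
noncomputable def covDirection (S : Matrix (Fin n) (Fin n) ℝ) (a : Fin n → ℝ) : Fin n → ℝ :=
  (√(a ⬝ᵥ (S *ᵥ a)))⁻¹ • (S *ᵥ a)

theorem dotProduct_covDirection {S : Matrix (Fin n) (Fin n) ℝ} (a : Fin n → ℝ) :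
    a ⬝ᵥ covDirection S a = √(a ⬝ᵥ (S *ᵥ a)) := by
  rw [covDirection, dotProduct_smul, smul_eq_mul, inv_mul_eq_div, Real.div_sqrt]

theorem dotProduct_vecMulVec_mulVec (u x y : Fin n → ℝ) :
    x ⬝ᵥ (Matrix.vecMulVec u u *ᵥ y) = (x ⬝ᵥ u) * (u ⬝ᵥ y) := by
  rw [Matrix.vecMulVec_mulVec]
  simp [dotProduct_smul, mul_comm]

/-- This is Cauchy–Schwarz for S. Splitting S into uuᵀ and a semidefinite residual serves both the
extremal distribution and weak duality. -/
theorem posSemidef_sub_covDirection {S : Matrix (Fin n) (Fin n) ℝ} (hS : S.PosSemidef)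
    (a : Fin n → ℝ) :
    (S - Matrix.vecMulVec (covDirection S a) (covDirection S a)).PosSemidef := by
  refine .of_dotProduct_mulVec_nonneg (hS.isHermitian.sub ?_) fun x => ?_
  · simpa using (Matrix.posSemidef_vecMulVec_self_star (covDirection S a)).isHermitian
  · have hs : 0 ≤ a ⬝ᵥ (S *ᵥ a) := by simpa using hS.dotProduct_mulVec_nonneg a
    have hx : 0 ≤ x ⬝ᵥ (S *ᵥ x) := by simpa using hS.dotProduct_mulVec_nonneg x
    rw [star_trivial, Matrix.sub_mulVec, dotProduct_sub, dotProduct_vecMulVec_mulVec,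
      dotProduct_comm (covDirection S a) x, covDirection, dotProduct_smul, smul_eq_mul, sub_nonneg,
      ← sq, mul_pow, inv_pow, Real.sq_sqrt hs, inv_mul_eq_div]
    exact div_le_of_le_mul₀ hs hx (dotProduct_mulVec_sq_le hS x a)

theorem dotProduct_sub_covDirection {S : Matrix (Fin n) (Fin n) ℝ} (hS : S.PosSemidef)
    (a : Fin n → ℝ) :
    a ⬝ᵥ ((S - Matrix.vecMulVec (covDirection S a) (covDirection S a)) *ᵥ a) = 0 := by
  have hs : 0 ≤ a ⬝ᵥ (S *ᵥ a) := by simpa using hS.dotProduct_mulVec_nonneg a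
  rw [Matrix.sub_mulVec, dotProduct_sub, dotProduct_vecMulVec_mulVec,
    dotProduct_comm (covDirection S a) a, dotProduct_covDirection, Real.mul_self_sqrt hs, sub_self]

end

/-! ### Extremal distributions and sharpness of Cantelli's bound -/

section

variable {n : ℕ}

/-- The mixture `w • p + (1 - w) • q` of two measures. -/
noncomputable def mixture {Ω : Type*} [MeasurableSpace Ω] (w : ℝ) (p q : Measure Ω) : Measure Ω :=
  ENNReal.ofReal w • p + ENNReal.ofReal (1 - w) • q

theorem isProbabilityMeasure_mixture {Ω : Type*} [MeasurableSpace Ω] {w : ℝ} (h0 : 0 ≤ w)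
    (h1 : w ≤ 1) (p q : Measure Ω) [IsProbabilityMeasure p] [IsProbabilityMeasure q] :
    IsProbabilityMeasure (mixture w p q) := by
  refine ⟨?_⟩
  simp [mixture, ← ENNReal.ofReal_add h0 (sub_nonneg.2 h1)]

theorem integrable_mixture {Ω E : Type*} [MeasurableSpace Ω] [NormedAddCommGroup E]
    {p q : Measure Ω} {f : Ω → E} (hp : Integrable f p) (hq : Integrable f q) (w : ℝ) :
    Integrable f (mixture w p q) :=
  (hp.smul_measure ENNReal.ofReal_ne_top).add_measure (hq.smul_measure ENNReal.ofReal_ne_top)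

theorem integral_mixture {Ω E : Type*} [MeasurableSpace Ω] [NormedAddCommGroup E]
    [NormedSpace ℝ E] {w : ℝ} (h0 : 0 ≤ w) (h1 : w ≤ 1)
    {p q : Measure Ω} {f : Ω → E} (hp : Integrable f p) (hq : Integrable f q) :
    ∫ ω, f ω ∂(mixture w p q) = w • ∫ ω, f ω ∂p + (1 - w) • ∫ ω, f ω ∂q := by
  rw [mixture, integral_add_measure (hp.smul_measure ENNReal.ofReal_ne_top)
    (hq.smul_measure ENNReal.ofReal_ne_top), integral_smul_measure, integral_smul_measure,
    ENNReal.toReal_ofReal h0, ENNReal.toReal_ofReal (sub_nonneg.2 h1)]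

theorem memLp_two_mixture {Ω E : Type*} [MeasurableSpace Ω] [NormedAddCommGroup E]
    [InnerProductSpace ℝ E] {p q : Measure Ω} {f : Ω → E} (hp : MemLp f 2 p) (hq : MemLp f 2 q)
    (w : ℝ) : MemLp f 2 (mixture w p q) := by
  have hm : AEStronglyMeasurable f (mixture w p q) :=
    (hp.1.smul_measure _).add_measure (hq.1.smul_measure _)
  rw [memLp_two_iff_integrable_sq_norm hm]
  exact integrable_mixture ((memLp_two_iff_integrable_sq_norm hp.1).1 hp)
    ((memLp_two_iff_integrable_sq_norm hq.1).1 hq) w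

/-- A distribution with mean `μ` and covariance matrix `S` for which `⟪a, ·⟫` takes two values. -/
theorem exists_measure_two_values {S : Matrix (Fin n) (Fin n) ℝ} (hS : S.PosSemidef)
    (μ a : EuclideanSpace ℝ (Fin n)) {r : ℝ} (hr : 0 < r) :
    ∃ p : Measure (EuclideanSpace ℝ (Fin n)), IsProbabilityMeasure p ∧
      MemLp (fun ζ => ζ) 2 p ∧ ∫ ζ, ζ ∂p = μ ∧ covMatrix p = S ∧
      ∀ T : Set (EuclideanSpace ℝ (Fin n)),
        (∀ ζ ∈ T, inner ℝ a ζ ≠ inner ℝ a μ + r * √(a.ofLp ⬝ᵥ (S *ᵥ a.ofLp))) →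
        p.real T ≤ r ^ 2 / (1 + r ^ 2) := by
  set u := covDirection S a.ofLp with hu
  set S' := S - Matrix.vecMulVec u u with hS'
  have hpsd : S'.PosSemidef := posSemidef_sub_covDirection hS _
  -- Two Gaussians with residual covariance S', which a does not see. With weights w and 1 - w, the
  -- shifts r u and -u/r average to zero, and their second moment is (w r² + (1 - w)/r²) uuᵀ = uuᵀ,
  -- which restores S.
  set m₁ : EuclideanSpace ℝ (Fin n) := μ + r • WithLp.toLp 2 u with hm₁
  set m₂ : EuclideanSpace ℝ (Fin n) := μ - r⁻¹ • WithLp.toLp 2 u with hm₂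
  set w : ℝ := 1 / (1 + r ^ 2) with hw
  have hw0 : 0 ≤ w := by positivity
  have hw1 : 1 - w = r ^ 2 / (1 + r ^ 2) := by rw [hw]; field_simp; ring
  have hw1' : w ≤ 1 := by
    have : 0 ≤ 1 - w := by rw [hw1]; positivity
    linarith
  have hL (m : EuclideanSpace ℝ (Fin n)) : MemLp (fun ζ => ζ) 2 (multivariateGaussian m S') :=
    IsGaussian.memLp_two_fun_id
  have hL1 (m : EuclideanSpace ℝ (Fin n)) :
      Integrable (fun ζ => ζ) (multivariateGaussian m S') := (hL m).integrable one_le_two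
  have hcov (m : EuclideanSpace ℝ (Fin n)) : covMatrix (multivariateGaussian m S') = S' := by
    ext i j
    exact covariance_eval_multivariateGaussian hpsd i j
  have hprod (m : EuclideanSpace ℝ (Fin n)) (i j : Fin n) :
      ∫ ζ : EuclideanSpace ℝ (Fin n), ζ i * ζ j ∂(multivariateGaussian m S') =
        S' i j + m i * m j := by
    have h := covariance_eq_sub (memLp_eval (hL m) i) (memLp_eval (hL m) j)
    rw [covariance_eval_multivariateGaussian hpsd, integral_apply (hL m), integral_apply (hL m),
      integral_id_multivariateGaussian] at h
    simp only [Pi.mul_apply] at h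
    linarith
  have hint (m : EuclideanSpace ℝ (Fin n)) (i j : Fin n) :
      Integrable (fun ζ : EuclideanSpace ℝ (Fin n) => ζ i * ζ j) (multivariateGaussian m S') :=
    (memLp_eval (hL m) i).integrable_mul (memLp_eval (hL m) j)
  have hprob := isProbabilityMeasure_mixture hw0 hw1' (multivariateGaussian m₁ S')
    (multivariateGaussian m₂ S')
  have hmean : ∫ ζ, ζ ∂(mixture w (multivariateGaussian m₁ S') (multivariateGaussian m₂ S'))
      = μ := by
    rw [integral_mixture hw0 hw1' (hL1 _) (hL1 _), integral_id_multivariateGaussian,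
      integral_id_multivariateGaussian, hw1, hw, hm₁, hm₂]
    ext i
    simp only [PiLp.add_apply, PiLp.sub_apply, PiLp.smul_apply, smul_eq_mul]
    field_simp
    ring
  have hLp := memLp_two_mixture (hL m₁) (hL m₂) w
  refine ⟨_, hprob, hLp, hmean, ?_, fun T hT => ?_⟩
  · ext i j
    change cov[fun ζ : EuclideanSpace ℝ (Fin n) => ζ i, fun ζ => ζ j; _] = S i j
    rw [covariance_eq_sub (memLp_eval hLp i) (memLp_eval hLp j),
      integral_apply hLp, integral_apply hLp, hmean]
    simp only [Pi.mul_apply]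
    rw [integral_mixture hw0 hw1' (hint m₁ i j) (hint m₂ i j), hprod, hprod, hw1, hw, hm₁,
      hm₂, hS']
    simp only [PiLp.add_apply, PiLp.sub_apply, PiLp.smul_apply, smul_eq_mul, Matrix.sub_apply,
      Matrix.vecMulVec_apply]
    field_simp
    ring
  · have hzero : multivariateGaussian m₁ S' T = 0 := by
      have hvar : Var[fun ζ => inner ℝ a ζ; multivariateGaussian m₁ S'] = 0 := by
        rw [variance_inner (hL m₁), hcov]
        exact dotProduct_sub_covDirection hS _
      have hae := ae_eq_integral_of_variance_eq_zero ((hL m₁).const_inner a) hvar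
      refine measure_mono_null (fun ζ hζ (h : inner ℝ a ζ = _) => hT ζ hζ ?_)
        (ae_iff.1 hae)
      have hin : inner ℝ a (WithLp.toLp 2 u) = √(a.ofLp ⬝ᵥ (S *ᵥ a.ofLp)) := by
        rw [inner_eq_dotProduct]
        exact dotProduct_covDirection _
      rw [h, integral_inner_id (hL m₁), integral_id_multivariateGaussian, hm₁, inner_add_right,
        inner_smul_right, hin]
    rw [Measure.real, mixture, Measure.add_apply, Measure.smul_apply, Measure.smul_apply, hzero,
      smul_zero, zero_add, smul_eq_mul, ENNReal.toReal_mul,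
      ENNReal.toReal_ofReal (sub_nonneg.2 hw1'), ← hw1]
    exact mul_le_of_le_one_right (sub_nonneg.2 hw1') (measureReal_le_one)

theorem robustlyReliable_momentClass_iff (g : EuclideanSpace ℝ (Fin n) → ℝ)
    (x : EuclideanSpace ℝ (Fin n)) {ε : ℝ} (hε0 : 0 < ε) (hε1 : ε < 1)
    (U : Set (EuclideanSpace ℝ (Fin n))) {V : Set (Matrix (Fin n) (Fin n) ℝ)}
    (hV : ∀ S ∈ V, S.PosSemidef) :
    RobustlyReliable g x ε (momentClass U V) ↔
      ∀ μ ∈ U, ∀ S ∈ V, g x + inner ℝ (gradient g x) μ +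
        kappa ε * √((gradient g x).ofLp ⬝ᵥ (S *ᵥ (gradient g x).ofLp)) ≤ 0 := by
  unfold RobustlyReliable
  generalize gradient g x = a
  have hκ : 0 < (1 - ε) / ε := div_pos (by linarith) hε0
  have hκ' : 0 < kappa ε := Real.sqrt_pos.2 hκ
  constructor
  · intro h μ hμ S hS
    by_contra! hpos
    set σ := √(a.ofLp ⬝ᵥ (S *ᵥ a.ofLp)) with hσ
    set b := g x + inner ℝ a μ with hb
    have hσ0 : 0 ≤ σ := Real.sqrt_nonneg _
    -- At r = κ the mass bound r²/(1 + r²) is exactly 1 - ε, which is no contradiction. The strict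
    -- violation leaves room for a smaller r.
    obtain ⟨r, hr0, hrκ, hrpos⟩ : ∃ r, 0 < r ∧ r < kappa ε ∧ 0 < b + r * σ := by
      rcases hσ0.eq_or_lt with h0 | h0
      · refine ⟨kappa ε / 2, by positivity, by linarith, ?_⟩
        rw [← h0] at hpos ⊢
        simpa using hpos
      · have : -b / σ < kappa ε := by
          rw [div_lt_iff₀ h0]
          linarith
        obtain ⟨r, h1, h2⟩ := exists_between (max_lt hκ' this)
        refine ⟨r, (le_max_left _ _).trans_lt h1, h2, ?_⟩
        have := (le_max_right _ _).trans_lt h1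
        rw [div_lt_iff₀ h0] at this
        linarith
    obtain ⟨p, hp, hLp, hmean, hcov, hT⟩ := exists_measure_two_values (hV S hS) μ a hr0
    have h1 := h p ⟨hp, hLp, hmean ▸ hμ, hcov ▸ hS⟩
    have h2 := hT {ζ | g x + inner ℝ a ζ ≤ 0} fun ζ hζ h => by
      have : g x + inner ℝ a ζ ≤ 0 := hζ
      rw [h] at this
      linarith
    have hr2 : r ^ 2 < (1 - ε) / ε := by
      have := pow_lt_pow_left₀ hrκ hr0.le two_ne_zero
      rwa [kappa, Real.sq_sqrt hκ.le] at this
    rw [lt_div_iff₀ hε0] at hr2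
    have h3 := h1.trans h2
    rw [le_div_iff₀ (by positivity)] at h3
    linarith
  · rintro h p ⟨hp, hLp, hmean, hcov⟩
    have hin : MemLp (fun ζ : EuclideanSpace ℝ (Fin n) => inner ℝ a ζ) 2 p := hLp.const_inner a
    have hX : MemLp (fun ζ : EuclideanSpace ℝ (Fin n) => g x + inner ℝ a ζ) 2 p :=
      (memLp_const (g x)).add hin
    have hXm : Measurable fun ζ : EuclideanSpace ℝ (Fin n) => g x + inner ℝ a ζ := by fun_prop
    refine one_sub_le_measureReal_nonpos hX hXm hε0 hε1 ?_
    rw [integral_add (integrable_const _) (hin.integrable one_le_two),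
      variance_const_add hin.1, variance_inner hLp, integral_inner_id hLp]
    simpa using h _ hmean _ hcov

end

/-! ### The semidefinite cone of dual variables -/

section

variable {n k : ℕ}

theorem matInner_add_left {m : ℕ} (X Y Z : Matrix (Fin m) (Fin n) ℝ) :
    matInner (X + Y) Z = matInner X Z + matInner Y Z := by
  simp [matInner, Matrix.add_mul]

theorem matInner_add_right {m : ℕ} (X Y Z : Matrix (Fin m) (Fin n) ℝ) :
    matInner X (Y + Z) = matInner X Y + matInner X Z := by
  simp [matInner, Matrix.mul_add]

theorem matInner_smul_left {m : ℕ} (c : ℝ) (X Y : Matrix (Fin m) (Fin n) ℝ) :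
    matInner (c • X) Y = c * matInner X Y := by
  simp [matInner]

theorem matInner_smul_right {m : ℕ} (c : ℝ) (X Y : Matrix (Fin m) (Fin n) ℝ) :
    matInner X (c • Y) = c * matInner X Y := by
  simp [matInner]

theorem matInner_vecMulVec {S : Matrix (Fin n) (Fin n) ℝ} (hS : S.IsSymm) (x : Fin n → ℝ) :
    matInner S (Matrix.vecMulVec x x) = x ⬝ᵥ (S *ᵥ x) := by
  rw [matInner, hS.eq, Matrix.mul_vecMulVec, Matrix.trace_vecMulVec, dotProduct_comm]

theorem matInner_comm {m : ℕ} (X Y : Matrix (Fin m) (Fin n) ℝ) : matInner X Y = matInner Y X := by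
  rw [matInner, matInner, ← Matrix.trace_transpose, Matrix.transpose_mul, Matrix.transpose_transpose]

open scoped MatrixOrder Matrix.Norms.L2Operator in
theorem exists_eq_conjTranspose_mul_self {S : Matrix (Fin n) (Fin n) ℝ} (hS : S.PosSemidef) :
    ∃ R : Matrix (Fin n) (Fin n) ℝ, S = Rᴴ * R :=
  CStarAlgebra.nonneg_iff_eq_star_mul_self.1 hS.nonneg

/-- With S = RᴴR, the inner product is the trace of the semidefinite matrix R W Rᴴ. -/
theorem matInner_nonneg {S W : Matrix (Fin n) (Fin n) ℝ} (hS : S.PosSemidef) (hW : W.PosSemidef) :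
    0 ≤ matInner S W := by
  obtain ⟨R, rfl⟩ := exists_eq_conjTranspose_mul_self hS
  have h := (hW.mul_mul_conjTranspose_same R).trace_nonneg
  rw [Matrix.trace_mul_comm, ← Matrix.mul_assoc] at h
  simpa [matInner, Matrix.transpose_mul] using h

theorem isSymm_vecMulVec (x : Fin n → ℝ) : (Matrix.vecMulVec x x).IsSymm := by
  ext i j
  simp [Matrix.vecMulVec_apply, mul_comm]

theorem posSemidef_iff_isSymm {S : Matrix (Fin n) (Fin n) ℝ} :
    S.PosSemidef ↔ S.IsSymm ∧ ∀ x, 0 ≤ x ⬝ᵥ (S *ᵥ x) := by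
  simp [Matrix.posSemidef_iff_dotProduct_mulVec]

/-- For fixed (x, t) the condition is affine in (W, z), so convexity and closedness of the cone can
be read off. -/
theorem blockMatrix_posSemidef_iff {W : Matrix (Fin n) (Fin n) ℝ} {a : EuclideanSpace ℝ (Fin n)}
    {z : ℝ} : (blockMatrix W a z).PosSemidef ↔
      W.IsSymm ∧ ∀ (x : Fin n → ℝ) (t : ℝ), 0 ≤ x ⬝ᵥ (W *ᵥ x) + t * (a.ofLp ⬝ᵥ x) + z * t ^ 2 := by
  have hq (x : Fin n → ℝ) (t : ℝ) :
      Sum.elim x (fun _ : Unit => t) ⬝ᵥ (blockMatrix W a z *ᵥ Sum.elim x (fun _ : Unit => t)) =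
        x ⬝ᵥ (W *ᵥ x) + t * (a.ofLp ⬝ᵥ x) + z * t ^ 2 := by
    rw [blockMatrix, Matrix.fromBlocks_mulVec, sumElim_dotProduct_sumElim, dotProduct_add]
    have h1 : x ⬝ᵥ ((Matrix.of fun i (_ : Unit) => a i / 2) *ᵥ fun _ => t) =
        t * (a.ofLp ⬝ᵥ x) / 2 := by
      simp only [dotProduct, Matrix.mulVec, Finset.mul_sum, Finset.sum_div, Matrix.of_apply,
        Finset.univ_unique, Finset.sum_singleton]
      exact Finset.sum_congr rfl fun i _ => by ring
    have h2 : ((Matrix.of fun (_ : Unit) j => a j / 2) *ᵥ x) () = (a.ofLp ⬝ᵥ x) / 2 := by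
      simp only [dotProduct, Matrix.mulVec, Finset.sum_div, Matrix.of_apply]
      exact Finset.sum_congr rfl fun i _ => by ring
    have h3 : ((Matrix.of fun (_ : Unit) (_ : Unit) => z) *ᵥ fun _ => t) () = z * t := by
      simp [Matrix.mulVec, dotProduct]
    have h4 (y : Unit → ℝ) : (fun _ : Unit => t) ⬝ᵥ y = t * y () := by simp [dotProduct]
    simp only [Sum.elim_comp_inl, Sum.elim_comp_inr]
    rw [h1, h4, Pi.add_apply, h2, h3]
    ring
  rw [Matrix.posSemidef_iff_dotProduct_mulVec]
  refine and_congr ?_ ?_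
  · rw [blockMatrix, Matrix.isHermitian_fromBlocks_iff]
    simp only [Matrix.isHermitian_iff_isSymm]
    refine ⟨fun h => h.1, fun h => ⟨h, ?_, ?_, ?_⟩⟩ <;> (ext i j; simp)
  · refine ⟨fun h x t => hq x t ▸ by simpa using h (Sum.elim x fun _ => t), fun h y => ?_⟩
    have := h (y ∘ Sum.inl) (y (Sum.inr ()))
    rw [← hq] at this
    have hy : Sum.elim (y ∘ Sum.inl) (fun _ : Unit => y (Sum.inr ())) = y := by
      ext i
      rcases i with i | i <;> rfl
    rw [hy] at this
    simpa using this

theorem posSemidef_of_blockMatrix {W : Matrix (Fin n) (Fin n) ℝ} {a : EuclideanSpace ℝ (Fin n)}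
    {z : ℝ} (h : (blockMatrix W a z).PosSemidef) : W.PosSemidef := by
  rw [blockMatrix_posSemidef_iff] at h
  exact posSemidef_iff_isSymm.2 ⟨h.1, fun x => by simpa using h.2 x 0⟩

theorem nonneg_of_blockMatrix {W : Matrix (Fin n) (Fin n) ℝ} {a : EuclideanSpace ℝ (Fin n)}
    {z : ℝ} (h : (blockMatrix W a z).PosSemidef) : 0 ≤ z := by
  rw [blockMatrix_posSemidef_iff] at h
  simpa using h.2 0 1

/-- The quadratic form is the completed square z (t + aᵀx/(2z))². By the Schur complement this is
the smallest W for the given z, so these pairs come arbitrarily close to the dual optimum. -/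
theorem blockMatrix_vecMulVec_posSemidef (a : EuclideanSpace ℝ (Fin n)) {z : ℝ} (hz : 0 < z) :
    (blockMatrix ((4 * z)⁻¹ • Matrix.vecMulVec a.ofLp a.ofLp) a z).PosSemidef := by
  refine blockMatrix_posSemidef_iff.2 ⟨(isSymm_vecMulVec _).smul _, fun x t => ?_⟩
  rw [Matrix.smul_mulVec, dotProduct_smul, dotProduct_vecMulVec_mulVec, dotProduct_comm x,
    smul_eq_mul]
  have : (4 * z)⁻¹ * (a.ofLp ⬝ᵥ x * a.ofLp ⬝ᵥ x) + t * a.ofLp ⬝ᵥ x + z * t ^ 2 =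
      z * (t + (a.ofLp ⬝ᵥ x) / (2 * z)) ^ 2 := by
    field_simp
    ring
  rw [this]
  positivity

/-- Weak duality. -/
theorem mul_sqrt_le_matInner_add {S W : Matrix (Fin n) (Fin n) ℝ} {a : EuclideanSpace ℝ (Fin n)}
    {z : ℝ} (hS : S.PosSemidef) (h : (blockMatrix W a z).PosSemidef) (κ : ℝ) :
    κ * √(a.ofLp ⬝ᵥ (S *ᵥ a.ofLp)) ≤ matInner S W + κ ^ 2 * z := by
  set u := covDirection S a.ofLp with hu
  have h1 := matInner_nonneg (posSemidef_sub_covDirection hS a.ofLp) (posSemidef_of_blockMatrix h)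
  have hb := blockMatrix_posSemidef_iff.1 h
  -- Testing the block form at (u, -κ) gives κ√(aᵀSa) ≤ uᵀWu + κ²z; the residual S - uuᵀ only adds a
  -- nonnegative term.
  have h2 := hb.2 u (-κ)
  rw [hu, dotProduct_covDirection, ← hu] at h2
  have h3 : matInner S W = matInner (S - Matrix.vecMulVec u u) W + u ⬝ᵥ (W *ᵥ u) := by
    rw [← matInner_vecMulVec hb.1, matInner_comm W, ← matInner_add_left, sub_add_cancel]
  linarith

/-- The pairs `(W, z)` with positive semidefinite block matrix. -/
def blockCone (a : EuclideanSpace ℝ (Fin n)) : Set (Matrix (Fin n) (Fin n) ℝ × ℝ) :=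
  {P | (blockMatrix P.1 a P.2).PosSemidef}

theorem convex_blockCone (a : EuclideanSpace ℝ (Fin n)) : Convex ℝ (blockCone a) := by
  intro P hP Q hQ s t hs ht hst
  have hP' := blockMatrix_posSemidef_iff.1 hP
  have hQ' := blockMatrix_posSemidef_iff.1 hQ
  refine blockMatrix_posSemidef_iff.2 ⟨(hP'.1.smul s).add (hQ'.1.smul t), fun x r => ?_⟩
  have h1 := mul_nonneg hs (hP'.2 x r)
  have h2 := mul_nonneg ht (hQ'.2 x r)
  simp only [Prod.fst_add, Prod.smul_fst, Prod.snd_add, Prod.smul_snd, Matrix.add_mulVec,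
    Matrix.smul_mulVec, dotProduct_add, dotProduct_smul, smul_eq_mul]
  have : r * (a.ofLp ⬝ᵥ x) = s * (r * (a.ofLp ⬝ᵥ x)) + t * (r * (a.ofLp ⬝ᵥ x)) := by
    rw [← add_mul, hst, one_mul]
  linarith

theorem isClosed_blockCone (a : EuclideanSpace ℝ (Fin n)) : IsClosed (blockCone a) := by
  have : blockCone a = {P | P.1ᵀ = P.1} ∩ ⋂ (x : Fin n → ℝ) (t : ℝ),
      {P | 0 ≤ x ⬝ᵥ (P.1 *ᵥ x) + t * (a.ofLp ⬝ᵥ x) + P.2 * t ^ 2} := by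
    ext P
    simp only [blockCone, Set.mem_ofPred_eq, blockMatrix_posSemidef_iff, Set.mem_inter_iff,
      Set.mem_iInter]
    rfl
  rw [this]
  refine (isClosed_eq (by fun_prop) (by fun_prop)).inter
    (isClosed_iInter fun x => isClosed_iInter fun t => isClosed_le continuous_const ?_)
  fun_prop

/-- Testing M at eᵢ ± eⱼ gives 2|Mᵢⱼ| ≤ Mᵢᵢ + Mⱼⱼ. -/
theorem abs_apply_le_trace {M : Matrix (Fin n) (Fin n) ℝ} (hM : M.PosSemidef) (i j : Fin n) :
    |M i j| ≤ M.trace := by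
  have hd (l : Fin n) : M l l ≤ M.trace :=
    Finset.single_le_sum (f := fun l => M l l) (fun l _ => hM.diag_nonneg) (Finset.mem_univ l)
  have h0 := hM.dotProduct_mulVec_nonneg (Pi.single i 1 + Pi.single j 1)
  have h1 := hM.dotProduct_mulVec_nonneg (Pi.single i 1 - Pi.single j 1)
  have hs : M j i = M i j := (posSemidef_iff_isSymm.1 hM).1.apply i j
  simp [Matrix.mulVec_add, Matrix.mulVec_sub, add_dotProduct, sub_dotProduct, dotProduct_sub,
    dotProduct_add, hs] at h0 h1
  have := hd i
  have := hd j
  exact abs_le.2 ⟨by linarith, by linarith⟩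

/-- Writing S₀ = RᴴR with R invertible, R W Rᴴ is semidefinite with trace S₀ • W ≤ C, so its entries
are bounded. Undoing the congruence places the set inside a compact image. -/
theorem isCompact_blockCone_truncated (a : EuclideanSpace ℝ (Fin n))
    {S₀ : Matrix (Fin n) (Fin n) ℝ} (hS₀ : S₀.PosDef) {κ : ℝ} (hκ : 0 < κ) (C : ℝ) :
    IsCompact (blockCone a ∩ {P | matInner S₀ P.1 + κ ^ 2 * P.2 ≤ C}) := by
  obtain ⟨R, hR⟩ := exists_eq_conjTranspose_mul_self hS₀.posSemidef
  have hRdet : IsUnit R.det := by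
    have := hS₀.det_pos
    rw [hR, Matrix.det_mul, Matrix.det_conjTranspose] at this
    exact isUnit_iff_ne_zero.2 fun h => by simp [h] at this
  have hcl : IsClosed (blockCone a ∩ {P | matInner S₀ P.1 + κ ^ 2 * P.2 ≤ C}) := by
    refine (isClosed_blockCone a).inter (isClosed_le ?_ continuous_const)
    unfold matInner
    fun_prop
  have hbox : IsCompact
      (({M : Matrix (Fin n) (Fin n) ℝ | ∀ i j, M i j ∈ Set.Icc (-C) C}) ×ˢ
        Set.Icc 0 (C / κ ^ 2)) := by
    refine IsCompact.prod ?_ isCompact_Icc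
    have : IsCompact (Set.univ.pi fun _ : Fin n => Set.univ.pi fun _ : Fin n =>
        Set.Icc (-C) C) := isCompact_univ_pi fun _ => isCompact_univ_pi fun _ => isCompact_Icc
    convert! this using 1
    ext M
    exact ⟨fun h i _ j _ => h i j, fun h i j => h i trivial j trivial⟩
  have himage := hbox.image (f := fun P : Matrix (Fin n) (Fin n) ℝ × ℝ =>
    (R⁻¹ * P.1 * (R⁻¹)ᵀ, P.2)) (by fun_prop)
  refine himage.of_isClosed_subset hcl ?_
  rintro ⟨W, z⟩ ⟨hW, hC⟩
  have hC : matInner S₀ W + κ ^ 2 * z ≤ C := hC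
  have hpsd := posSemidef_of_blockMatrix hW
  have hz : 0 ≤ z := nonneg_of_blockMatrix hW
  have hM := hpsd.mul_mul_conjTranspose_same R
  have htr : (R * W * Rᴴ).trace = matInner S₀ W := by
    rw [Matrix.trace_mul_comm, ← Matrix.mul_assoc, ← hR, matInner,
      (posSemidef_iff_isSymm.1 hS₀.posSemidef).1.eq]
  have hin := matInner_nonneg hS₀.posSemidef hpsd
  have hκz : 0 ≤ κ ^ 2 * z := by positivity
  refine ⟨(R * W * Rᴴ, z), ⟨fun i j => ?_, hz, ?_⟩, ?_⟩
  · have := abs_apply_le_trace hM i j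
    rw [htr] at this
    exact abs_le.1 (by linarith)
  · rw [le_div_iff₀ (by positivity)]
    show z * κ ^ 2 ≤ C
    linarith
  · have h1 : R⁻¹ * (R * W * Rᴴ) * (R⁻¹)ᵀ = W := by
      rw [Matrix.conjTranspose_eq_transpose_of_trivial, Matrix.transpose_nonsing_inv,
        Matrix.mul_assoc R, Matrix.nonsing_inv_mul_cancel_left _ _ hRdet,
        Matrix.mul_nonsing_inv_cancel_right]
      simpa using hRdet
    exact Prod.ext h1 rfl

end

/-! ### Minimax and strong duality -/

section

variable {n k : ℕ}

/-- The Lagrangian `(S₀ + B Z Bᵀ) • W + κ² z`. -/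
noncomputable def lagrangian (S₀ : Matrix (Fin n) (Fin n) ℝ) (B : Matrix (Fin n) (Fin k) ℝ) (κ : ℝ)
    (P : Matrix (Fin n) (Fin n) ℝ × ℝ) (Z : Matrix (Fin k) (Fin k) ℝ) : ℝ :=
  matInner (S₀ + B * Z * Bᵀ) P.1 + κ ^ 2 * P.2

variable (S₀ : Matrix (Fin n) (Fin n) ℝ) (B : Matrix (Fin n) (Fin k) ℝ) (κ : ℝ)

theorem lagrangian_convexCombo_left (P Q : Matrix (Fin n) (Fin n) ℝ × ℝ)
    (Z : Matrix (Fin k) (Fin k) ℝ) (s t : ℝ) :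
    lagrangian S₀ B κ (s • P + t • Q) Z =
      s * lagrangian S₀ B κ P Z + t * lagrangian S₀ B κ Q Z := by
  simp only [lagrangian, Prod.fst_add, Prod.snd_add, Prod.smul_fst, Prod.smul_snd,
    matInner_add_right, matInner_smul_right, smul_eq_mul]
  ring

theorem lagrangian_convexCombo_right (P : Matrix (Fin n) (Fin n) ℝ × ℝ)
    (Y Z : Matrix (Fin k) (Fin k) ℝ) {s t : ℝ} (hst : s + t = 1) :
    lagrangian S₀ B κ P (s • Y + t • Z) =
      s * lagrangian S₀ B κ P Y + t * lagrangian S₀ B κ P Z := by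
  obtain rfl : s = 1 - t := by linarith
  simp only [lagrangian, Matrix.mul_add, Matrix.add_mul, Matrix.mul_smul, Matrix.smul_mul,
    matInner_add_left, matInner_smul_left]
  ring

theorem continuous_lagrangian_left (Z : Matrix (Fin k) (Fin k) ℝ) :
    Continuous fun P => lagrangian S₀ B κ P Z := by
  unfold lagrangian matInner
  fun_prop

theorem continuous_lagrangian_right (P : Matrix (Fin n) (Fin n) ℝ × ℝ) :
    Continuous fun Z => lagrangian S₀ B κ P Z := by
  unfold lagrangian matInner
  fun_prop

variable {S₀ κ}

/-- A saddle point of the Lagrangian on the (non-compact) cone of dual variables. -/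
theorem exists_isSaddlePointOn_lagrangian (hS₀ : S₀.PosDef) (hκ : 0 < κ)
    {K : Set (Matrix (Fin k) (Fin k) ℝ)} (hKconv : Convex ℝ K) (hKc : IsCompact K) (hK0 : 0 ∈ K)
    (a : EuclideanSpace ℝ (Fin n)) :
    ∃ P ∈ blockCone a, ∃ Z ∈ K, IsSaddlePointOn (blockCone a) K (lagrangian S₀ B κ) P Z := by
  set f := lagrangian S₀ B κ with hf
  set P₁ : Matrix (Fin n) (Fin n) ℝ × ℝ :=
    ((4 * 1 : ℝ)⁻¹ • Matrix.vecMulVec a.ofLp a.ofLp, 1)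
  have hP₁ : P₁ ∈ blockCone a := blockMatrix_vecMulVec_posSemidef a one_pos
  obtain ⟨V, hV⟩ := hKc.bddAbove_image (continuous_lagrangian_right S₀ B κ P₁).continuousOn
  have hV (Z) (hZ : Z ∈ K) : f P₁ Z ≤ V := hV ⟨Z, hZ, rfl⟩
  have hf0 (P) : f P 0 = matInner S₀ P.1 + κ ^ 2 * P.2 := by simp [hf, lagrangian]
  -- Any saddle point P on X satisfies f P 0 ≤ f P₁ Z ≤ V, so the extra 1 keeps the truncation
  -- inactive at P.
  set X := blockCone a ∩ {P | matInner S₀ P.1 + κ ^ 2 * P.2 ≤ V + 1} with hX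
  have hmemX {P} (h1 : P ∈ blockCone a) (h2 : f P 0 ≤ V + 1) : P ∈ X :=
    ⟨h1, by rw [hf0] at h2; exact h2⟩
  have hP₁X : P₁ ∈ X := hmemX hP₁ (by linarith [hV 0 hK0])
  have hXconv : Convex ℝ X := by
    intro P hP Q hQ s t hs ht hst
    have h1 : f P 0 ≤ V + 1 := by rw [hf0]; exact hP.2
    have h2 : f Q 0 ≤ V + 1 := by rw [hf0]; exact hQ.2
    refine hmemX (convex_blockCone a hP.1 hQ.1 hs ht hst) ?_
    rw [hf, lagrangian_convexCombo_left, ← hf]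
    calc s * f P 0 + t * f Q 0 ≤ s * (V + 1) + t * (V + 1) := by gcongr
      _ = V + 1 := by rw [← add_mul, hst, one_mul]
  obtain ⟨P, hPX, Z, hZ, hsad⟩ := Sion.exists_isSaddlePointOn (f := f) ⟨P₁, hP₁X⟩ hXconv
    (isCompact_blockCone_truncated a hS₀ hκ (V + 1))
    (fun Z _ => (continuous_lagrangian_left S₀ B κ Z).lowerSemicontinuous.lowerSemicontinuousOn _)
    (fun Z _ => ConvexOn.quasiconvexOn ⟨hXconv, fun P _ Q _ s t _ _ _ =>
      (lagrangian_convexCombo_left S₀ B κ P Q Z s t).le⟩)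
    hKconv ⟨0, hK0⟩ hKc
    (fun P _ => (continuous_lagrangian_right S₀ B κ P).upperSemicontinuous.upperSemicontinuousOn _)
    (fun P _ => ConcaveOn.quasiconcaveOn ⟨hKconv, fun Y _ Z _ s t _ _ hst =>
      (lagrangian_convexCombo_right S₀ B κ P Y Z hst).ge⟩)
  refine ⟨P, hPX.1, Z, hZ, fun Q hQ Y hY => (hsad P hPX Y hY).trans ?_⟩
  have hP0 : f P 0 ≤ V := (hsad P₁ hP₁X 0 hK0).trans (hV Z hZ)
  set d := |f Q 0 - f P 0|
  have hd : 0 ≤ d := abs_nonneg _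
  -- A step this short from P towards Q raises f · 0 by at most 1 and so stays in X. As f is affine
  -- in P, the saddle inequality there extends to Q.
  set t := 1 / (1 + d) with ht
  have ht0 : 0 < t := by positivity
  have ht1 : t ≤ 1 := (div_le_one (by positivity)).2 (by linarith)
  have htd : t * (f Q 0 - f P 0) ≤ 1 := by
    refine (mul_le_mul_of_nonneg_left (le_abs_self _) ht0.le).trans ?_
    rw [ht, one_div_mul_eq_div, div_le_one (by positivity)]
    linarith
  have hmem : (1 - t) • P + t • Q ∈ X := by
    refine hmemX (convex_blockCone a hPX.1 hQ (by linarith) ht0.le (by ring)) ?_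
    rw [hf, lagrangian_convexCombo_left, ← hf]
    linarith
  have h := hsad _ hmem Z hZ
  rw [hf, lagrangian_convexCombo_left, ← hf] at h
  have : t * f P Z ≤ t * f Q Z := by linarith
  exact le_of_mul_le_mul_left this ht0

/-- Strong duality for the worst-case standard deviation over a set of covariance matrices. -/
theorem forall_mul_sqrt_le_iff_exists_blockMatrix (hS₀ : S₀.PosDef) (hκ : 0 < κ)
    {K : Set (Matrix (Fin k) (Fin k) ℝ)} (hKconv : Convex ℝ K) (hKc : IsCompact K) (hK0 : 0 ∈ K)
    (hKsymm : ∀ Z ∈ K, Z.IsSymm) (a : EuclideanSpace ℝ (Fin n)) (τ : ℝ) :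
    (∀ Z ∈ K, (S₀ + B * Z * Bᵀ).PosSemidef →
        κ * √(a.ofLp ⬝ᵥ ((S₀ + B * Z * Bᵀ) *ᵥ a.ofLp)) ≤ τ) ↔
      ∃ (z : ℝ) (W : Matrix (Fin n) (Fin n) ℝ), W.IsSymm ∧
        (∀ Z ∈ K, matInner (S₀ + B * Z * Bᵀ) W + κ ^ 2 * z ≤ τ) ∧
        (blockMatrix W a z).PosSemidef := by
  constructor
  · intro h
    obtain ⟨⟨W, z⟩, hP, Z, hZ, hsad⟩ :=
      exists_isSaddlePointOn_lagrangian B hS₀ hκ hKconv hKc hK0 a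
    have hW := blockMatrix_posSemidef_iff.1 hP
    refine ⟨z, W, hW.1, fun Y hY => (hsad _ hP Y hY).trans ?_, hP⟩
    have hsymm : (S₀ + B * Z * Bᵀ).IsSymm := by
      refine (posSemidef_iff_isSymm.1 hS₀.posSemidef).1.add ?_
      rw [Matrix.IsSymm, Matrix.transpose_mul, Matrix.transpose_mul, Matrix.transpose_transpose,
        (hKsymm Z hZ).eq, Matrix.mul_assoc]
    have hpsd : (S₀ + B * Z * Bᵀ).PosSemidef := by
      refine posSemidef_iff_isSymm.2 ⟨hsymm, fun x => ?_⟩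
      -- The cone is closed under adding xxᵀ to W, so minimality of (W, z) forces xᵀSx ≥ 0 at the
      -- saddle covariance S. The constraint S ⪰ 0 thus needs no multiplier.
      have hmem : (W + Matrix.vecMulVec x x, z) ∈ blockCone a := by
        refine blockMatrix_posSemidef_iff.2 ⟨hW.1.add (isSymm_vecMulVec x), fun y t => ?_⟩
        rw [Matrix.add_mulVec, dotProduct_add, dotProduct_vecMulVec_mulVec, dotProduct_comm x y]
        linarith [hW.2 y t, mul_self_nonneg (y ⬝ᵥ x)]
      have := hsad _ hmem Z hZ
      simp only [lagrangian, matInner_add_right, matInner_vecMulVec hsymm] at this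
      linarith
    set s := a.ofLp ⬝ᵥ ((S₀ + B * Z * Bᵀ) *ᵥ a.ofLp) with hs
    have hs0 : 0 ≤ s := (posSemidef_iff_isSymm.1 hpsd).2 _
    have hτ : κ * √s ≤ τ := h Z hZ hpsd
    refine le_of_forall_pos_le_add fun δ hδ => ?_
    -- The function s/(4y) + κ²y has infimum κ√s, attained at √s/(2κ) if s > 0. The shift keeps y
    -- positive when s = 0 and costs at most δ.
    set y : ℝ := (√s + 2 * δ / κ) / (2 * κ) with hy
    have hq : 0 < √s + 2 * δ / κ := by positivity
    have hy0 : 0 < y := by positivity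
    have hv := hsad ((4 * y)⁻¹ • Matrix.vecMulVec a.ofLp a.ofLp, y)
      (blockMatrix_vecMulVec_posSemidef a hy0) Z hZ
    simp only [lagrangian, matInner_smul_right, matInner_vecMulVec hsymm, ← hs] at hv
    refine (show lagrangian S₀ B κ (W, z) Z ≤ _ from hv).trans ?_
    have h1 : (4 * y)⁻¹ * s ≤ κ * √s / 2 := by
      rw [inv_mul_le_iff₀ (by positivity)]
      have : 4 * y * (κ * √s / 2) = (√s + 2 * δ / κ) * √s := by
        rw [hy]; field_simp; ring
      rw [this, add_mul, Real.mul_self_sqrt hs0]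
      have : 0 ≤ 2 * δ / κ * √s := by positivity
      linarith
    have h2 : κ ^ 2 * y = κ * √s / 2 + δ := by
      rw [hy]; field_simp
    linarith
  · rintro ⟨z, W, -, hle, hpsd⟩ Z hZ hS
    exact (mul_sqrt_le_matInner_add hS hpsd κ).trans (hle Z hZ)

end

/-! ### Dual norms and assembly of the two models -/

section

variable {n m k : ℕ}

theorem isGreatest_dotProduct_normInf (v : Fin m → ℝ) {α : ℝ} (hα : 0 ≤ α) :
    IsGreatest ((fun z => v ⬝ᵥ z) '' {z | normInf z ≤ α}) (α * normOne v) := by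
  refine ⟨⟨fun i => α * SignType.sign (v i), ?_, ?_⟩, ?_⟩
  · refine (pi_norm_le_iff_of_nonneg hα).2 fun i => ?_
    rw [Real.norm_eq_abs, abs_mul, abs_of_nonneg hα]
    refine mul_le_of_le_one_right hα ?_
    rcases lt_trichotomy (v i) 0 with h | h | h <;> simp [h]
  · simp only [dotProduct, normOne, Finset.mul_sum]
    refine Finset.sum_congr rfl fun i _ => ?_
    rw [mul_left_comm, self_mul_sign]
  · rintro _ ⟨z, hz, rfl⟩
    simp only [dotProduct, normOne, Finset.mul_sum]
    refine Finset.sum_le_sum fun i _ => ?_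
    have h := (norm_le_pi_norm z i).trans hz
    calc v i * z i ≤ |v i| * |z i| := (le_abs_self _).trans (abs_mul _ _).le
      _ ≤ |v i| * α := by gcongr; exact h
      _ = α * |v i| := mul_comm _ _

theorem dotProduct_le_normTwo_mul (v z : Fin m → ℝ) : v ⬝ᵥ z ≤ normTwo v * normTwo z := by
  have := Real.sum_mul_le_sqrt_mul_sqrt Finset.univ v z
  simpa only [normTwo, dotProduct, ← sq] using this

theorem isGreatest_dotProduct_normTwo (v : Fin m → ℝ) {α : ℝ} (hα : 0 ≤ α) :
    IsGreatest ((fun z => v ⬝ᵥ z) '' {z | normTwo z ≤ α}) (α * normTwo v) := by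
  have hvv : 0 ≤ v ⬝ᵥ v := Finset.sum_nonneg fun i _ => mul_self_nonneg _
  have hv : 0 ≤ normTwo v := Real.sqrt_nonneg _
  have hsq : v ⬝ᵥ v = normTwo v * normTwo v := (Real.mul_self_sqrt hvv).symm
  refine ⟨⟨(α / normTwo v) • v, ?_, ?_⟩, ?_⟩
  · show √(((α / normTwo v) • v) ⬝ᵥ ((α / normTwo v) • v)) ≤ α
    rw [smul_dotProduct, dotProduct_smul, smul_eq_mul, smul_eq_mul, hsq]
    refine Real.sqrt_le_iff.2 ⟨hα, ?_⟩
    rcases hv.eq_or_lt with h | h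
    · simp [← h, sq_nonneg]
    · exact le_of_eq (by field_simp)
  · show v ⬝ᵥ ((α / normTwo v) • v) = α * normTwo v
    rw [dotProduct_smul, smul_eq_mul, hsq]
    rcases hv.eq_or_lt with h | h
    · simp [← h]
    · field_simp
  · rintro _ ⟨z, hz, rfl⟩
    refine (dotProduct_le_normTwo_mul v z).trans ?_
    rw [mul_comm]
    exact mul_le_mul_of_nonneg_right hz hv

theorem matInner_eq_sum (X Y : Matrix (Fin m) (Fin n) ℝ) :
    matInner X Y = ∑ i, ∑ j, X i j * Y i j := by
  rw [Finset.sum_comm]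
  simp [matInner, Matrix.trace, Matrix.mul_apply]

/-- The maximizer is β times the sign matrix of M, symmetric because M is; restricting to symmetric
Z therefore loses nothing. -/
theorem isGreatest_matInner_matNormInf {M : Matrix (Fin k) (Fin k) ℝ} (hM : M.IsSymm) {β : ℝ}
    (hβ : 0 ≤ β) :
    IsGreatest ((fun Z => matInner Z M) '' {Z | Z.IsSymm ∧ matNormInf Z ≤ β})
      (β * matNormOne M) := by
  refine ⟨⟨Matrix.of fun i j => β * SignType.sign (M i j), ⟨?_, ?_⟩, ?_⟩, ?_⟩
  · ext i j
    simp [hM.apply i j]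
  · refine (pi_norm_le_iff_of_nonneg hβ).2 fun i => (pi_norm_le_iff_of_nonneg hβ).2 fun j => ?_
    rw [Matrix.of_apply, Real.norm_eq_abs, abs_mul, abs_of_nonneg hβ]
    refine mul_le_of_le_one_right hβ ?_
    rcases lt_trichotomy (M i j) 0 with h | h | h <;> simp [h]
  · simp only [matInner_eq_sum, matNormOne, Finset.mul_sum, Matrix.of_apply]
    refine Finset.sum_congr rfl fun i _ => Finset.sum_congr rfl fun j _ => ?_
    rw [mul_assoc, sign_mul_self]
  · rintro _ ⟨Z, ⟨-, hZ⟩, rfl⟩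
    simp only [matInner_eq_sum, matNormOne, Finset.mul_sum]
    refine Finset.sum_le_sum fun i _ => Finset.sum_le_sum fun j _ => ?_
    have h : |Z i j| ≤ β :=
      (norm_le_pi_norm (Z i) j).trans ((norm_le_pi_norm (fun i j => Z i j) i).trans hZ)
    calc Z i j * M i j ≤ |Z i j| * |M i j| := (le_abs_self _).trans (abs_mul _ _).le
      _ ≤ β * |M i j| := by gcongr

theorem matInner_le_matNormFrob_mul (X Y : Matrix (Fin m) (Fin n) ℝ) :
    matInner X Y ≤ matNormFrob X * matNormFrob Y := by
  have := Real.sum_mul_le_sqrt_mul_sqrt Finset.univ (fun p : Fin m × Fin n => X p.1 p.2)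
    (fun p => Y p.1 p.2)
  simpa only [matNormFrob, matInner_eq_sum, ← sq, Fintype.sum_prod_type] using this

theorem isGreatest_matInner_matNormFrob {M : Matrix (Fin k) (Fin k) ℝ} (hM : M.IsSymm) {β : ℝ}
    (hβ : 0 ≤ β) :
    IsGreatest ((fun Z => matInner Z M) '' {Z | Z.IsSymm ∧ matNormFrob Z ≤ β})
      (β * matNormFrob M) := by
  have hMM : 0 ≤ matInner M M := by
    rw [matInner_eq_sum]
    exact Finset.sum_nonneg fun i _ => Finset.sum_nonneg fun j _ => mul_self_nonneg _
  have hM0 : 0 ≤ matNormFrob M := Real.sqrt_nonneg _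
  have hsq : matInner M M = matNormFrob M * matNormFrob M := (Real.mul_self_sqrt hMM).symm
  -- The equality case of Cauchy–Schwarz; for M = 0 division by zero makes the witness 0, which
  -- still attains the value.
  refine ⟨⟨(β / matNormFrob M) • M, ⟨hM.smul _, ?_⟩, ?_⟩, ?_⟩
  · rw [matNormFrob, matInner_smul_left, matInner_smul_right, hsq]
    refine Real.sqrt_le_iff.2 ⟨hβ, ?_⟩
    rcases hM0.eq_or_lt with h | h
    · simp [← h, sq_nonneg]
    · exact le_of_eq (by field_simp)
  · simp only [matInner_smul_left, hsq]
    rcases hM0.eq_or_lt with h | h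
    · simp [← h]
    · field_simp
  · rintro _ ⟨Z, ⟨-, hZ⟩, rfl⟩
    exact (matInner_le_matNormFrob_mul Z M).trans (mul_le_mul_of_nonneg_right hZ hM0)

theorem convex_setOf_isSymm : Convex ℝ {Z : Matrix (Fin k) (Fin k) ℝ | Z.IsSymm} :=
  fun _ hX _ hY s t _ _ _ => (Matrix.IsSymm.smul hX s).add (Matrix.IsSymm.smul hY t)

theorem isClosed_setOf_isSymm : IsClosed {Z : Matrix (Fin k) (Fin k) ℝ | Z.IsSymm} :=
  isClosed_eq (by fun_prop) continuous_id

section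

attribute [local instance] Matrix.normedAddCommGroup Matrix.normedSpace

/-- As a ball for an actual norm, the set inherits convexity and compactness. -/
theorem setOf_isSymm_matNormInf_le (β : ℝ) :
    {Z : Matrix (Fin k) (Fin k) ℝ | Z.IsSymm ∧ matNormInf Z ≤ β} =
      {Z | Z.IsSymm} ∩ Metric.closedBall 0 β := by
  ext Z
  simp only [Set.mem_inter_iff, mem_closedBall_zero_iff]
  rfl

theorem convex_setOf_matNormInf_le (β : ℝ) :
    Convex ℝ {Z : Matrix (Fin k) (Fin k) ℝ | Z.IsSymm ∧ matNormInf Z ≤ β} := by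
  rw [setOf_isSymm_matNormInf_le]
  exact convex_setOf_isSymm.inter (convex_closedBall 0 β)

theorem isCompact_setOf_matNormInf_le (β : ℝ) :
    IsCompact {Z : Matrix (Fin k) (Fin k) ℝ | Z.IsSymm ∧ matNormInf Z ≤ β} := by
  rw [setOf_isSymm_matNormInf_le]
  have : ProperSpace (Matrix (Fin k) (Fin k) ℝ) := FiniteDimensional.proper ℝ _
  exact (isCompact_closedBall 0 β).inter_left isClosed_setOf_isSymm

end

section

attribute [local instance] Matrix.frobeniusNormedAddCommGroup Matrix.frobeniusNormedSpace

theorem setOf_isSymm_matNormFrob_le (β : ℝ) :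
    {Z : Matrix (Fin k) (Fin k) ℝ | Z.IsSymm ∧ matNormFrob Z ≤ β} =
      {Z | Z.IsSymm} ∩ Metric.closedBall 0 β := by
  ext Z
  simp only [Set.mem_inter_iff, mem_closedBall_zero_iff]
  rw [Matrix.frobenius_norm_def, ← Real.sqrt_eq_rpow]
  simp only [Set.mem_ofPred_eq, matNormFrob, matInner_eq_sum, ← sq, Real.rpow_two,
    Real.norm_eq_abs, sq_abs]

theorem convex_setOf_matNormFrob_le (β : ℝ) :
    Convex ℝ {Z : Matrix (Fin k) (Fin k) ℝ | Z.IsSymm ∧ matNormFrob Z ≤ β} := by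
  rw [setOf_isSymm_matNormFrob_le]
  exact convex_setOf_isSymm.inter (convex_closedBall 0 β)

theorem isCompact_setOf_matNormFrob_le (β : ℝ) :
    IsCompact {Z : Matrix (Fin k) (Fin k) ℝ | Z.IsSymm ∧ matNormFrob Z ≤ β} := by
  rw [setOf_isSymm_matNormFrob_le]
  have : ProperSpace (Matrix (Fin k) (Fin k) ℝ) := FiniteDimensional.proper ℝ _
  exact (isCompact_closedBall 0 β).inter_left isClosed_setOf_isSymm

end

theorem matInner_conj (B : Matrix (Fin n) (Fin k) ℝ) (Z : Matrix (Fin k) (Fin k) ℝ)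
    (W : Matrix (Fin n) (Fin n) ℝ) : matInner (B * Z * Bᵀ) W = matInner Z (Bᵀ * W * B) := by
  rw [matInner, matInner, Matrix.transpose_mul, Matrix.transpose_mul, Matrix.transpose_transpose,
    Matrix.mul_assoc B, Matrix.trace_mul_comm]
  simp only [Matrix.mul_assoc]

/-- The dual reformulation of the robust constraint, for a pair of norms given through the support
functions of their balls. -/
theorem robustlyReliable_iff_exists_blockMatrix (g : EuclideanSpace ℝ (Fin n) → ℝ)
    (x : EuclideanSpace ℝ (Fin n)) {ε : ℝ} (hε0 : 0 < ε) (hε1 : ε < 1)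
    (μ₀ : EuclideanSpace ℝ (Fin n)) {S₀ : Matrix (Fin n) (Fin n) ℝ} (hS₀ : S₀.PosDef)
    (A : Matrix (Fin n) (Fin m) ℝ) (B : Matrix (Fin n) (Fin k) ℝ) {α β : ℝ}
    {N N' : (Fin m → ℝ) → ℝ} {F F' : Matrix (Fin k) (Fin k) ℝ → ℝ}
    (hN : ∀ v, IsGreatest ((fun z => v ⬝ᵥ z) '' {z | N z ≤ α}) (α * N' v))
    (hF : ∀ M, M.IsSymm →
      IsGreatest ((fun Z => matInner Z M) '' {Z | Z.IsSymm ∧ F Z ≤ β}) (β * F' M))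
    (hF0 : F 0 ≤ β) (hconv : Convex ℝ {Z | Z.IsSymm ∧ F Z ≤ β})
    (hcomp : IsCompact {Z | Z.IsSymm ∧ F Z ≤ β}) :
    RobustlyReliable g x ε (momentClass (meanSet N μ₀ A α) (covSet F S₀ B β)) ↔
      ∃ (z : ℝ) (W : Matrix (Fin n) (Fin n) ℝ), W.IsSymm ∧
        g x + inner ℝ (gradient g x) μ₀ + α * N' (Aᵀ *ᵥ (gradient g x).ofLp)
          + matInner S₀ W + β * F' (Bᵀ * W * B) + kappa ε ^ 2 * z ≤ 0 ∧
        (blockMatrix W (gradient g x) z).PosSemidef := by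
  rw [robustlyReliable_momentClass_iff g x hε0 hε1 _ fun S hS => hS.2]
  generalize gradient g x = a
  have hκ : 0 < kappa ε := Real.sqrt_pos.2 (div_pos (by linarith) hε0)
  have hinner (z : Fin m → ℝ) : inner ℝ a (μ₀ + WithLp.toLp 2 (A *ᵥ z)) =
      inner ℝ a μ₀ + (Aᵀ *ᵥ a.ofLp) ⬝ᵥ z := by
    rw [inner_add_right, inner_eq_dotProduct a (WithLp.toLp 2 (A *ᵥ z)),
      Matrix.dotProduct_mulVec,
      Matrix.mulVec_transpose]
  -- Mean and covariance vary independently, so the maximizing mean can be fixed once for every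
  -- covariance.
  obtain ⟨⟨z₀, hz₀, hz₀'⟩, hNub⟩ := hN (Aᵀ *ᵥ a.ofLp)
  have hmean : (∀ μ ∈ meanSet N μ₀ A α, ∀ S ∈ covSet F S₀ B β,
      g x + inner ℝ a μ + kappa ε * √(a.ofLp ⬝ᵥ (S *ᵥ a.ofLp)) ≤ 0) ↔
      ∀ Z ∈ {Z : Matrix (Fin k) (Fin k) ℝ | Z.IsSymm ∧ F Z ≤ β}, (S₀ + B * Z * Bᵀ).PosSemidef →
        kappa ε * √(a.ofLp ⬝ᵥ ((S₀ + B * Z * Bᵀ) *ᵥ a.ofLp)) ≤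
          -(g x + inner ℝ a μ₀ + α * N' (Aᵀ *ᵥ a.ofLp)) := by
    constructor
    · intro h Z hZ hpsd
      have := h _ ⟨z₀, hz₀, rfl⟩ _ ⟨⟨Z, hZ.1, hZ.2, rfl⟩, hpsd⟩
      rw [hinner, show (Aᵀ *ᵥ a.ofLp) ⬝ᵥ z₀ = _ from hz₀'] at this
      linarith
    · rintro h _ ⟨z, hz, rfl⟩ _ ⟨⟨Z, hZ, hZβ, rfl⟩, hpsd⟩
      have h1 := h Z ⟨hZ, hZβ⟩ hpsd
      have h2 : (Aᵀ *ᵥ a.ofLp) ⬝ᵥ z ≤ _ := hNub ⟨z, hz, rfl⟩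
      rw [hinner]
      linarith
  rw [hmean, forall_mul_sqrt_le_iff_exists_blockMatrix B hS₀ hκ hconv hcomp
    ⟨Matrix.isSymm_zero, hF0⟩ (fun Z hZ => hZ.1)]
  refine exists_congr fun z => exists_congr fun W => and_congr_right fun hW =>
    and_congr_left fun _ => ?_
  have hBW : (Bᵀ * W * B).IsSymm := by
    rw [Matrix.IsSymm, Matrix.transpose_mul, Matrix.transpose_mul, Matrix.transpose_transpose,
      hW.eq, Matrix.mul_assoc]
  obtain ⟨⟨Z₀, hZ₀, hZ₀'⟩, hFub⟩ := hF _ hBW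
  constructor
  · intro h
    have := h Z₀ hZ₀
    rw [matInner_add_left, matInner_conj, show matInner Z₀ _ = _ from hZ₀'] at this
    linarith
  · intro h Z hZ
    have h2 : matInner Z (Bᵀ * W * B) ≤ _ := hFub ⟨Z, hZ, rfl⟩
    rw [matInner_add_left, matInner_conj]
    linarith

end

end RobustReliability

open RobustReliability in
theorem mainTheorem4 {n m k : ℕ} (g : EuclideanSpace ℝ (Fin n) → ℝ) (hg : Differentiable ℝ g)
    (x : EuclideanSpace ℝ (Fin n)) (ε : ℝ) (hε0 : 0 < ε) (hε1 : ε < 1)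
    (μ₀ : EuclideanSpace ℝ (Fin n)) (S₀ : Matrix (Fin n) (Fin n) ℝ) (hS₀ : S₀.PosDef)
    (A : Matrix (Fin n) (Fin m) ℝ) (B : Matrix (Fin n) (Fin k) ℝ)
    (α β : ℝ) (hα : 0 ≤ α) (hβ : 0 ≤ β) :
    (RobustlyReliable g x ε
        (momentClass (meanSet normInf μ₀ A α) (covSet matNormInf S₀ B β)) ↔
      ∃ (z : ℝ) (W : Matrix (Fin n) (Fin n) ℝ), W.IsSymm ∧
        g x + inner ℝ (gradient g x) μ₀ + α * normOne (Aᵀ *ᵥ (gradient g x).ofLp)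
          + matInner S₀ W + β * matNormOne (Bᵀ * W * B) + kappa ε ^ 2 * z ≤ 0 ∧
        (blockMatrix W (gradient g x) z).PosSemidef) ∧
    (RobustlyReliable g x ε
        (momentClass (meanSet normTwo μ₀ A α) (covSet matNormFrob S₀ B β)) ↔
      ∃ (z : ℝ) (W : Matrix (Fin n) (Fin n) ℝ), W.IsSymm ∧
        g x + inner ℝ (gradient g x) μ₀ + α * normTwo (Aᵀ *ᵥ (gradient g x).ofLp)
          + matInner S₀ W + β * matNormFrob (Bᵀ * W * B) + kappa ε ^ 2 * z ≤ 0 ∧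
        (blockMatrix W (gradient g x) z).PosSemidef) :=
  ⟨robustlyReliable_iff_exists_blockMatrix g x hε0 hε1 μ₀ hS₀ A B
    (fun v => isGreatest_dotProduct_normInf v hα) (fun _ hM => isGreatest_matInner_matNormInf hM hβ)
    ((pi_norm_le_iff_of_nonneg hβ).2 fun _ => (pi_norm_le_iff_of_nonneg hβ).2 fun _ => by simpa)
    (convex_setOf_matNormInf_le β) (isCompact_setOf_matNormInf_le β),
  robustlyReliable_iff_exists_blockMatrix g x hε0 hε1 μ₀ hS₀ A B
    (fun v => isGreatest_dotProduct_normTwo v hα)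
    (fun _ hM => isGreatest_matInner_matNormFrob hM hβ)
    (by simpa [matNormFrob, matInner])
    (convex_setOf_matNormFrob_le β) (isCompact_setOf_matNormFrob_le β)⟩
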